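/- Let $(\Omega,\mathcal F,\mathbb Q)$ be a probability space, where $\mathbb Q$ is a pricing measure, let $T\ge 0$ be a maturity, and let $\overline X_T=(X_T^1,\dots,X_T^n)$ be a random vector with $X_T^k\in L^1(\mathbb Q)$ and $X_T^k\ge 0$ almost surely for every $k$. Let $B$ be a deterministic non-decreasing bond function with $B_0=1$, and let $V^h=\mathbb E_{\mathbb Q}[B_T^{-1}h(\overline X_T)]$ denote the price at time $0$ of the European option with payoff $h(\overline X_T)$. Let $h:[0,\infty)^n\to\mathbb R$ be continuous. For $d\subseteq\{1,\dots,n\}$ with complement $z$, let $\mathbf 0^{z}h$ be the function of the variables $(y_i)_{i\in d}$ obtained from $h$ by setting the variables $y_i$, $i\in z$, equal to $0$, let $\mathbf 0^{z}\partial^{d}h=\big(\prod_{i\in d}\partial_i\big)\mathbf 0^{z}h$ be its mixed partial derivative in the sense of distributions on $(0,\infty)^{d}$, and let $G_d(y)=\mathbb Q\big(X_T^i>y_i \text{ for all } i\in d\big)$. Put $$|A|_{z,d,0,0}(h)=\int_{(0,\infty)^{d}} G_d\,\mathrm d\big|\mathbf 0^{z}\partial^{d}h\big| ,\qquad A_{z,d,0,0}(h)=\int_{(0,\infty)^{d}}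 G_d\,\mathrm d\big(\mathbf 0^{z}\partial^{d}h\big).$$ Here, for a distribution $S$ and the lower semicontinuous weight $G_d\ge 0$, the integrals are $\int G_d\,\mathrm d|S|=\sup\{S(\varphi):\varphi\in C_c^\infty((0,\infty)^d),\ |\varphi|\le G_d\}\in[0,\infty]$ and, when this is finite, $\int G_d\,\mathrm dS=\int G_d\,\mathrm dS^+-\int G_d\,\mathrm d(-S)^+$ with $\int G_d\,\mathrm dS^+=\sup\{S(\varphi):\varphi\in C_c^\infty((0,\infty)^d),\ 0\le\varphi\le G_d\}$; when $S$ is a signed Radon measure these are the usual integrals against $|S|$ and $S$. For $d=\emptyset$ the functionals are $|h(0)|$ and $h(0)$. Assume that $|A|_{z,d,0,0}(h)<\infty$ for every $d\subseteq\{1,\dots,n\}$, $z=\{1,\dots,n\}\setminus d$ (equivalently, for all binary multi-indices $z,d$ with $|z+d|=n$ and $\|z+d\|=\max_i(z_i+d_i)=1$). Then $h(\overline X_T)\in L^1(\mathbb Q)$ and $$V^h=B_T^{-1}\sum_{d\subseteq\{1,\dots,n\},\ z=\{1,\dots,n\}\setminus d}A_{z,d,0,0}(h).$$ -/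

import Mathlib

open MeasureTheory TopologicalSpace
open scoped NNReal ENNReal Distributions LineDeriv

namespace Pricing

noncomputable section

/-- A binary multi-index is a set `d` of coordinates.  This is the open positive orthant in the
variables `y_i`, `i ∈ d`. -/
def orthant {n : ℕ} (d : Finset (Fin n)) : Opens (d → ℝ) where
  carrier := {y | ∀ i, 0 < y i}
  is_open' := by
    simp only [Set.ofPred_forall]
    exact isOpen_iInter_of_finite fun i => isOpen_lt continuous_const (continuous_apply i)

/-- The point of `ℝⁿ` with coordinates `y_i` for `i ∈ d` and `0` for `i ∉ d`. -/
def extendZero {n : ℕ} (d : Finset (Fin n)) (y : d → ℝ) : Fin n → ℝ :=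
  fun i => if hi : i ∈ d then y ⟨i, hi⟩ else 0

/-- The function `𝟎^z h` of the variables `y_i`, `i ∈ d`, where `z` is the complement of `d`: the
variables outside `d` are set to `0`. -/
def zeroOp {n : ℕ} (d : Finset (Fin n)) (h : (Fin n → ℝ) → ℝ) : (d → ℝ) → ℝ :=
  fun y => h (extendZero d y)

/-- The regular distribution `φ ↦ ∫ φ g` on `Ω` given by a locally integrable function `g`. -/
def regularDistribution {ι : Type*} [Fintype ι] (Ω : Opens (ι → ℝ)) (g : (ι → ℝ) → ℝ) :
    𝓓'(Ω, ℝ) :=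
  UniformConvergenceCLM.ofFun _ _ _
    (TestFunction.integralAgainstBilinCLM (ContinuousLinearMap.mul ℝ ℝ) volume g)

/-- The distribution `𝟎^z ∂^d h` on the open orthant in the variables `y_i`, `i ∈ d`: the mixed
distributional derivative, once in each variable, of `𝟎^z h`, with `z` the complement of `d`. -/
def mixedDerivative {n : ℕ} (d : Finset (Fin n)) (h : (Fin n → ℝ) → ℝ) : 𝓓'(orthant d, ℝ) :=
  ∂^{fun j : Fin d.card => (Pi.single (d.orderIsoOfFin rfl j) 1 : d → ℝ)}
    (regularDistribution (orthant d) (zeroOp d h))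

/-- For a distribution `T` and a lower semicontinuous weight `w ≥ 0`, the integral `∫ w d|T|`
against the variation of `T`: the supremum of `T φ` over the test functions `φ` with `|φ| ≤ w`.
If `T` is a signed Radon measure, this is the integral of `w` against its total variation
measure; conversely, if the value is finite, then `T` is such a measure on `{w > 0}`. -/
def integralVariation {ι : Type*} [Fintype ι] {Ω : Opens (ι → ℝ)} (T : 𝓓'(Ω, ℝ))
    (w : (ι → ℝ) → ℝ) : ℝ≥0∞ :=
  ⨆ (φ : 𝓓(Ω, ℝ)) (_ : ∀ y, |φ y| ≤ w y), ENNReal.ofReal (T φ)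

/-- For a distribution `T` and a lower semicontinuous weight `w ≥ 0`, the integral `∫ w dT⁺`
against the positive part of `T`: the supremum of `T φ` over the test functions `φ` with
`0 ≤ φ ≤ w`. If `T` is a signed Radon measure, this is the integral of `w` against the positive
part of its Jordan decomposition. -/
def integralPosPart {ι : Type*} [Fintype ι] {Ω : Opens (ι → ℝ)} (T : 𝓓'(Ω, ℝ))
    (w : (ι → ℝ) → ℝ) : ℝ≥0∞ :=
  ⨆ (φ : 𝓓(Ω, ℝ)) (_ : ∀ y, 0 ≤ φ y ∧ φ y ≤ w y), ENNReal.ofReal (T φ)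

/-- The integral `∫ w dT = ∫ w dT⁺ - ∫ w dT⁻`, where `T⁻ = (-T)⁺`, of a lower semicontinuous
weight `w ≥ 0` against a distribution `T`; it is meaningful if `∫ w d|T|` is finite, and both
terms are then finite. -/
def integralAgainst {ι : Type*} [Fintype ι] {Ω : Opens (ι → ℝ)} (T : 𝓓'(Ω, ℝ))
    (w : (ι → ℝ) → ℝ) : ℝ :=
  (integralPosPart T w).toReal - (integralPosPart (-T) w).toReal

/-- The joint strict tail `y ↦ ℚ(⋀_{i ∈ d} (Xⁱ > y_i))` of the random vector `X`; it is lower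
semicontinuous. -/
def tail {Ω : Type*} [MeasurableSpace Ω] (Q : Measure Ω) {n : ℕ} (X : Ω → Fin n → ℝ)
    (d : Finset (Fin n)) (y : d → ℝ) : ℝ :=
  Q.real {ω | ∀ i : d, y i < X ω i}

/-- `|A|_{z,d,0,0}(h) = ∫ ℚ(⋀_{i ∈ d} (Xⁱ > y_i)) |𝟎^z ∂^d h|(dy)`, where `z` is the complement
of `d`. -/
def absA {Ω : Type*} [MeasurableSpace Ω] (Q : Measure Ω) {n : ℕ} (X : Ω → Fin n → ℝ)
    (d : Finset (Fin n)) (h : (Fin n → ℝ) → ℝ) : ℝ≥0∞ :=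
  integralVariation (mixedDerivative d h) (tail Q X d)

/-- `A_{z,d,0,0}(h) = ∫ ℚ(⋀_{i ∈ d} (Xⁱ > y_i)) (𝟎^z ∂^d h)(dy)`, where `z` is the complement
of `d`. -/
def A {Ω : Type*} [MeasurableSpace Ω] (Q : Measure Ω) {n : ℕ} (X : Ω → Fin n → ℝ)
    (d : Finset (Fin n)) (h : (Fin n → ℝ) → ℝ) : ℝ :=
  integralAgainst (mixedDerivative d h) (tail Q X d)

/-- The price at time `0`, under the pricing measure `Q` and with bond value `b` at maturity, of
the European option with payoff `h(X)` at maturity: the expectation of the discounted payoff. -/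
def price {Ω : Type*} [MeasurableSpace Ω] (Q : Measure Ω) (b : ℝ) {n : ℕ} (X : Ω → Fin n → ℝ)
    (h : (Fin n → ℝ) → ℝ) : ℝ :=
  ∫ ω, b⁻¹ * h (X ω) ∂Q

end

end Pricing

/-! Write `T` for the mixed derivative in the variables of `d`, and `G` for the joint tail. By
inclusion-exclusion, `h x` is the sum over `d` of its increments over the faces of the box from `0`
to `x` (`sum_boxIncrement`). Formally each increment is `T` applied to the indicator of the box, and
the expectation of the indicator of the random box `(0, X)` is `G`, so Fubini gives the formula.

Since `T` is only a distribution, indicators are replaced by smooth products `boxTest`, with `X`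
rounded to finitely many levels. By continuity of `h`, `T` of these products tends pointwise to the
increment (`tendsto_mixedDerivative_boxTest`). Their average over the law of `X` is a finite
combination, hence a test function between `0` and `G`, and `T` commutes with the averaging.

Two estimates remain. Near-optimal test functions for `T` and `-T`, shifted slightly towards the
origin, lie below these averages for large `k`, which forces the expectations to converge to `A`
(`tendsto_integral_boxTest`). Finiteness of `absA` gives uniform integrability
(`exists_small_event_bound`, `uniformIntegrable_boxTest`). Vitali's theorem then identifies the
limit with the expected increment (`integral_boxIncrement`). -/

open Filter Topology

namespace Pricing

noncomputable section

open Real (smoothTransition)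

variable {n : ℕ} {d : Finset (Fin n)}

/-! ### Product test functions, mixed derivatives and translations -/

/-- A smooth function of one variable with compact support in `(0, ∞)`. -/
structure IsCutoff (g : ℝ → ℝ) : Prop where
  contDiff : ContDiff ℝ (⊤ : ℕ∞) g
  hasCompactSupport : HasCompactSupport g
  tsupport_subset : tsupport g ⊆ Set.Ioi 0

theorem IsCutoff.deriv {g : ℝ → ℝ} (hg : IsCutoff g) : IsCutoff (deriv g) where
  contDiff := (contDiff_infty_iff_deriv.1 hg.contDiff).2
  hasCompactSupport := hg.hasCompactSupport.deriv
  tsupport_subset := (closure_minimal support_deriv_subset (isClosed_tsupport g)).trans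
    hg.tsupport_subset

/-- The product `y ↦ ∏ i, g i (y i)` as a test function on the orthant. -/
def prodTest (g : d → ℝ → ℝ) (hg : ∀ i, IsCutoff (g i)) : 𝓓(orthant d, ℝ) :=
  have hsub : tsupport (fun y : d → ℝ => ∏ i, g i (y i)) ⊆
      Set.univ.pi fun i => tsupport (g i) := by
    refine closure_minimal (fun y hy i _ => subset_tsupport _ ?_)
      (isClosed_set_pi fun i _ => isClosed_tsupport _)
    exact Finset.prod_ne_zero_iff.1 hy i (Finset.mem_univ i)
  { toFun := fun y => ∏ i, g i (y i)
    contDiff' := contDiff_prod fun i _ => (hg i).contDiff.comp (contDiff_apply ℝ ℝ i)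
    hasCompactSupport' := (isCompact_univ_pi fun i => (hg i).hasCompactSupport).of_isClosed_subset
      (isClosed_tsupport _) hsub
    tsupport_subset' := fun y hy i => (hg i).tsupport_subset (hsub hy i trivial) }

@[simp]
theorem prodTest_apply (g : d → ℝ → ℝ) (hg : ∀ i, IsCutoff (g i)) (y : d → ℝ) :
    prodTest g hg y = ∏ i, g i (y i) := rfl

theorem lineDerivOp_apply {Ω : Opens (d → ℝ)} (φ : 𝓓(Ω, ℝ)) (v y : d → ℝ) :
    (∂_{v} φ : 𝓓(Ω, ℝ)) y = lineDeriv ℝ φ y v :=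
  TestFunction.lineDerivCLM_apply_of_le (𝕜 := ℝ) (by simp)

theorem isCutoff_update {g : d → ℝ → ℝ} (hg : ∀ i, IsCutoff (g i)) (i j : d) :
    IsCutoff (Function.update g i (deriv (g i)) j) := by
  rcases eq_or_ne j i with rfl | hj
  · simpa using (hg j).deriv
  · simpa [hj] using hg j

theorem lineDerivOp_prodTest (g : d → ℝ → ℝ) (hg : ∀ i, IsCutoff (g i)) (i : d) :
    ∂_{(Pi.single i 1 : d → ℝ)} (prodTest g hg) =
      prodTest (Function.update g i (deriv (g i))) (isCutoff_update hg i) := by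
  ext y
  rw [lineDerivOp_apply]
  have hline : (fun t : ℝ => prodTest g hg (y + t • (Pi.single i 1 : d → ℝ))) =
      fun t => g i (y i + t) * ∏ j ∈ Finset.univ.erase i, g j (y j) := by
    funext t
    rw [prodTest_apply, ← Finset.mul_prod_erase _ _ (Finset.mem_univ i)]
    congr 1
    · simp
    · refine Finset.prod_congr rfl fun j hj => ?_
      simp [Finset.ne_of_mem_erase hj]
  rw [lineDeriv, hline, deriv_mul_const, deriv_comp_const_add, prodTest_apply,
    ← Finset.mul_prod_erase _ _ (Finset.mem_univ i)]
  · congr 1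
    · simp
    · refine Finset.prod_congr rfl fun j hj => ?_
      simp [Finset.ne_of_mem_erase hj]
  · have := (hg i).contDiff.differentiable (by simp)
    fun_prop

/-- Injectivity of `f` ensures that no factor is differentiated twice. The target family `g'` stays
fixed while the induction moves `g` towards it one factor at a time. -/
theorem iteratedLineDerivOp_prodTest {m : ℕ} (f : Fin m → d) (hf : Function.Injective f)
    (T : 𝓓'(orthant d, ℝ)) (g : d → ℝ → ℝ) (hg : ∀ i, IsCutoff (g i)) (g' : d → ℝ → ℝ)
    (hg' : ∀ i, IsCutoff (g' i)) (h_mem : ∀ j, g' (f j) = deriv (g (f j)))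
    (h_notMem : ∀ i, (∀ j, f j ≠ i) → g' i = g i) :
    (∂^{fun j => (Pi.single (f j) 1 : d → ℝ)} T) (prodTest g hg) =
      (-1) ^ m * T (prodTest g' hg') := by
  induction m generalizing g with
  | zero =>
    have : g = g' := funext fun i => (h_notMem i fun j => j.elim0).symm
    subst this
    simp
  | succ m ih =>
    rw [LineDeriv.iteratedLineDerivOp_succ_left, Distribution.lineDerivOp_apply_apply, map_neg,
      lineDerivOp_prodTest]
    have := ih (fun j => f j.succ) (hf.comp (Fin.succ_injective m)) (Function.update g (f 0)
      (deriv (g (f 0)))) (isCutoff_update hg (f 0)) ?_ ?_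
    · refine (congrArg Neg.neg this).trans ?_
      ring
    · intro j
      rw [h_mem, Function.update_of_ne]
      exact fun h => Fin.succ_ne_zero j (hf h)
    · intro i hi
      rcases eq_or_ne i (f 0) with rfl | hi0
      · simpa using h_mem 0
      · rw [Function.update_of_ne hi0]
        exact h_notMem i fun j => Fin.cases hi0.symm hi j

theorem regularDistribution_apply {Ω : Opens (d → ℝ)} {g : (d → ℝ) → ℝ} (hg : Continuous g)
    (φ : 𝓓(Ω, ℝ)) : regularDistribution Ω g φ = ∫ y, φ y * g y :=
  TestFunction.integralAgainstBilinCLM_eq_integral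
    (hg.locallyIntegrable.locallyIntegrableOn _)

theorem regularDistribution_congr {Ω : Opens (d → ℝ)} {g g' : (d → ℝ) → ℝ}
    (h : ∀ y ∈ Ω, g y = g' y) : regularDistribution Ω g = regularDistribution Ω g' := by
  -- The pairing is zero by default without local integrability, so this property has to transfer as
  -- well.
  have hloc : LocallyIntegrableOn g Ω ↔ LocallyIntegrableOn g' Ω := by
    rw [locallyIntegrableOn_iff Ω.isOpen.isLocallyClosed,
      locallyIntegrableOn_iff Ω.isOpen.isLocallyClosed]
    refine forall₃_congr fun k hk hc => ?_
    exact integrableOn_congr_fun (fun y hy => h y (hk hy)) hc.measurableSet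
  ext φ
  change TestFunction.integralAgainstBilinCLM (ContinuousLinearMap.mul ℝ ℝ) volume g φ =
    TestFunction.integralAgainstBilinCLM (ContinuousLinearMap.mul ℝ ℝ) volume g' φ
  rw [TestFunction.integralAgainstBilinCLM_apply, TestFunction.integralAgainstBilinCLM_apply]
  classical
  refine if_congr hloc (integral_congr_ae (ae_of_all _ fun y => ?_)) rfl
  by_cases hy : y ∈ tsupport φ
  · simp [h y (φ.tsupport_subset hy)]
  · simp [image_eq_zero_of_notMem_tsupport hy]

theorem continuous_extendZero : Continuous (extendZero d) := by
  refine continuous_pi fun i => ?_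
  unfold extendZero
  split_ifs
  · exact continuous_apply _
  · exact continuous_const

theorem continuous_zeroOp {h : (Fin n → ℝ) → ℝ} (hh : Continuous h) : Continuous (zeroOp d h) :=
  hh.comp continuous_extendZero

theorem mixedDerivative_prodTest {h : (Fin n → ℝ) → ℝ} (hh : Continuous h) (g : d → ℝ → ℝ)
    (hg : ∀ i, IsCutoff (g i)) :
    mixedDerivative d h (prodTest g hg) =
      ∫ y, (∏ i, -deriv (g i) (y i)) * zeroOp d h y := by
  have := iteratedLineDerivOp_prodTest (fun j => d.orderIsoOfFin rfl j)
    (d.orderIsoOfFin rfl).injective (regularDistribution (orthant d) (zeroOp d h)) g hg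
    (fun i => deriv (g i)) (fun i => (hg i).deriv) (fun _ => rfl)
    (fun i hi => (hi _ ((d.orderIsoOfFin rfl).apply_symm_apply i)).elim)
  refine this.trans ?_
  rw [regularDistribution_apply (continuous_zeroOp hh), ← integral_const_mul]
  simp [Finset.prod_neg, mul_assoc]

/-- Differentiation commutes with translation. As `φ'` is chosen before `u`, one function serves all
shifts, and the dependence on `u` becomes that of an ordinary integral. -/
theorem exists_iteratedLineDerivOp_translate {Ω : Opens (d → ℝ)} (T : 𝓓'(Ω, ℝ)) {m : ℕ}
    (v : Fin m → d → ℝ) (φ : 𝓓(Ω, ℝ)) :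
    ∃ φ' : 𝓓(Ω, ℝ), ∀ (u : d → ℝ) (ψ : 𝓓(Ω, ℝ)), (∀ y, ψ y = φ (y + u)) →
      ∃ ψ' : 𝓓(Ω, ℝ), (∀ y, ψ' y = φ' (y + u)) ∧ (∂^{v} T) ψ = T ψ' := by
  induction m generalizing φ with
  | zero => exact ⟨φ, fun u ψ hψ => ⟨ψ, hψ, rfl⟩⟩
  | succ m ih =>
    obtain ⟨φ', hφ'⟩ := ih (Fin.tail v) (-∂_{v 0} φ)
    refine ⟨φ', fun u ψ hψ => ?_⟩
    obtain ⟨ψ', hψ', hT⟩ := hφ' u (-∂_{v 0} ψ) fun y => by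
      have : ⇑ψ = fun y => φ (y + u) := funext hψ
      change -((∂_{v 0} ψ : 𝓓(Ω, ℝ)) y) = -((∂_{v 0} φ : 𝓓(Ω, ℝ)) (y + u))
      rw [lineDerivOp_apply, lineDerivOp_apply, this]
      simp only [lineDeriv, add_right_comm]
    refine ⟨ψ', hψ', ?_⟩
    rw [LineDeriv.iteratedLineDerivOp_succ_left, Distribution.lineDerivOp_apply_apply, hT]

theorem continuous_integral_translate {f φ : (d → ℝ) → ℝ} (hf : Continuous f) (hφ : Continuous φ)
    (hc : HasCompactSupport φ) : Continuous fun u : d → ℝ => ∫ y, φ (y + u) * f y := by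
  -- Moving the shift onto `f` fixes a compact domain of integration.
  have h : (fun u : d → ℝ => ∫ y, φ (y + u) * f y) =
      fun u => ∫ y in tsupport φ, φ y * f (y - u) := by
    funext u
    rw [setIntegral_eq_integral_of_forall_compl_eq_zero,
      ← integral_add_right_eq_self (fun y => φ y * f (y - u)) u]
    · simp
    · intro y hy
      simp [image_eq_zero_of_notMem_tsupport hy]
  rw [h]
  refine continuous_parametric_integral_of_continuous (f := fun u y => φ y * f (y - u)) ?_ hc
  simp only [Function.uncurry_def]
  fun_prop

/-- A test function on the orthant may be translated towards the origin by a small amount, with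
little effect on the value of the mixed derivative. -/
theorem exists_translate {h : (Fin n → ℝ) → ℝ} (hh : Continuous h) (φ : 𝓓(orthant d, ℝ))
    {δ : ℝ} (hδ : 0 < δ) :
    ∃ ε > 0, ∃ ψ : 𝓓(orthant d, ℝ), (∀ y, ψ y = φ (y + fun _ => ε)) ∧
      |mixedDerivative d h ψ - mixedDerivative d h φ| < δ := by
  obtain ⟨φ', hφ'⟩ := exists_iteratedLineDerivOp_translate
    (regularDistribution (orthant d) (zeroOp d h))
    (fun j : Fin d.card => (Pi.single (d.orderIsoOfFin rfl j) 1 : d → ℝ)) φ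
  have hcont := (continuous_integral_translate (continuous_zeroOp (d := d) hh) φ'.continuous
    φ'.hasCompactSupport).comp
      (continuous_pi fun _ => continuous_id : Continuous fun (ε : ℝ) (_ : d) => ε)
  obtain ⟨ψ₀, hψ₀, h₀⟩ := hφ' 0 φ (by simp)
  rw [regularDistribution_apply (continuous_zeroOp hh)] at h₀
  have hev := (Metric.tendsto_nhds.1 (hcont.tendsto 0) δ hδ)
  obtain ⟨r, hr, hthick⟩ := φ.hasCompactSupport.isCompact.exists_cthickening_subset_open
    (orthant d).isOpen φ.tsupport_subset
  have hsmall : ∀ᶠ ε : ℝ in 𝓝[>] 0, ε ∈ Set.Ioo 0 r := Ioo_mem_nhdsGT hr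
  obtain ⟨ε, hε, hεr⟩ := ((hev.filter_mono nhdsWithin_le_nhds).and hsmall).exists
  have hsub : tsupport (fun y => φ (y + fun _ => ε)) ⊆ orthant d := by
    intro y hy
    have hy' : y + (fun _ => ε) ∈ tsupport φ := by
      have := tsupport_comp_subset_preimage φ (f := fun y : d → ℝ => y + fun _ => ε) (by fun_prop)
      exact this hy
    apply hthick
    refine Metric.mem_cthickening_of_dist_le y _ r _ hy' ?_
    rw [dist_self_add_right, pi_norm_le_iff_of_nonneg hr.le]
    intro i
    simp [abs_of_pos hεr.1, hεr.2.le]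
  let ψ : 𝓓(orthant d, ℝ) :=
    { toFun := fun y => φ (y + fun _ => ε)
      contDiff' := φ.contDiff.comp (contDiff_id.add contDiff_const)
      hasCompactSupport' := φ.hasCompactSupport.comp_homeomorph (Homeomorph.addRight _)
      tsupport_subset' := hsub }
  refine ⟨ε, hεr.1, ψ, fun y => rfl, ?_⟩
  obtain ⟨ψ₁, hψ₁, h₁⟩ := hφ' (fun _ => ε) ψ fun y => rfl
  rw [regularDistribution_apply (continuous_zeroOp hh)] at h₁
  unfold mixedDerivative
  rw [h₁, h₀]
  simp only [hψ₁, hψ₀]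
  exact hε

/-! ### Smooth cutoffs of intervals -/

theorem smoothTransition_deriv_nonneg (t : ℝ) : 0 ≤ deriv smoothTransition t :=
  smoothTransition.monotone.deriv_nonneg

theorem smoothTransition_deriv_support :
    Function.support (deriv smoothTransition) ⊆ Set.Icc 0 1 := by
  intro t ht
  by_contra hmem
  apply ht
  rcases not_and_or.1 hmem with h | h
  · have : smoothTransition =ᶠ[𝓝 t] fun _ => 0 := by
      filter_upwards [Iio_mem_nhds (not_le.1 h)] with s hs
      exact smoothTransition.zero_of_nonpos (le_of_lt hs)
    rw [this.deriv_eq, deriv_const]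
  · have : smoothTransition =ᶠ[𝓝 t] fun _ => 1 := by
      filter_upwards [Ioi_mem_nhds (not_le.1 h)] with s hs
      exact smoothTransition.one_of_one_le (le_of_lt hs)
    rw [this.deriv_eq, deriv_const]

theorem smoothTransition_contDiff : ContDiff ℝ (⊤ : ℕ∞) smoothTransition :=
  smoothTransition.contDiff

theorem continuous_smoothTransition_deriv : Continuous (deriv smoothTransition) :=
  smoothTransition_contDiff.continuous_deriv (by simp)

theorem differentiable_smoothTransition : Differentiable ℝ smoothTransition :=
  smoothTransition_contDiff.differentiable (by simp)

theorem integral_smoothTransition_deriv : ∫ t, deriv smoothTransition t = 1 := by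
  have h := integral_of_hasDerivAt_of_tendsto (f := smoothTransition) (m := 0) (n := 1)
    (fun t => (differentiable_smoothTransition t).hasDerivAt)
    (continuous_smoothTransition_deriv.integrable_of_hasCompactSupport
      (HasCompactSupport.of_support_subset_isCompact isCompact_Icc smoothTransition_deriv_support))
    (tendsto_const_nhds.congr' ?_) (tendsto_const_nhds.congr' ?_)
  · simpa using h
  · filter_upwards [eventually_le_atBot 0] with t ht
    exact (smoothTransition.zero_of_nonpos ht).symm
  · filter_upwards [eventually_ge_atTop 1] with t ht
    exact (smoothTransition.one_of_one_le ht).symm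

/-- A smooth approximation from below of the indicator function of `(0, j / k)`. -/
def cutoff (k j : ℕ) (y : ℝ) : ℝ :=
  -- For `k > 0` and `j ≥ 2` this rises on `[1/k, 2/k]` and falls on `[(j-1)/k, j/k]`. For `j < 2`
  -- the difference would be nonpositive, hence the default `0`.
  if 2 ≤ j then smoothTransition (k * y - 1) - smoothTransition (k * y - j + 1) else 0

theorem cutoff_nonneg (k j : ℕ) (y : ℝ) : 0 ≤ cutoff k j y := by
  unfold cutoff
  split_ifs with hj
  · have : (2 : ℝ) ≤ j := by exact_mod_cast hj
    exact sub_nonneg.2 (smoothTransition.monotone (by linarith))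
  · exact le_rfl

theorem cutoff_le_one (k j : ℕ) (y : ℝ) : cutoff k j y ≤ 1 := by
  unfold cutoff
  split_ifs with hj
  · linarith [smoothTransition.le_one (k * y - 1), smoothTransition.nonneg (k * y - j + 1)]
  · exact zero_le_one

theorem cutoff_ne_zero {k j : ℕ} {y : ℝ} (h : cutoff k j y ≠ 0) : 1 < k * y ∧ k * y < j := by
  unfold cutoff at h
  split_ifs at h with hj
  · have : (2 : ℝ) ≤ j := by exact_mod_cast hj
    constructor
    · by_contra hy
      apply h
      rw [smoothTransition.zero_of_nonpos (by linarith),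
        smoothTransition.zero_of_nonpos (by linarith), sub_zero]
    · by_contra hy
      apply h
      rw [smoothTransition.one_of_one_le (by linarith),
        smoothTransition.one_of_one_le (by linarith), sub_self]
  · exact (h rfl).elim

theorem cutoff_eq_one {k j : ℕ} {y : ℝ} (h₁ : 2 ≤ k * y) (h₂ : k * y + 1 ≤ j) :
    cutoff k j y = 1 := by
  have hj : 2 ≤ j := by
    have : (2 : ℝ) ≤ j := by linarith
    exact_mod_cast this
  rw [cutoff, if_pos hj, smoothTransition.one_of_one_le (by linarith),
    smoothTransition.zero_of_nonpos (by linarith), sub_zero]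

theorem isCutoff_cutoff (k j : ℕ) : IsCutoff (cutoff k j) := by
  have hcont : ContDiff ℝ (⊤ : ℕ∞) (cutoff k j) := by
    unfold cutoff
    split_ifs
    · exact (smoothTransition_contDiff.comp (by fun_prop)).sub
        (smoothTransition_contDiff.comp (by fun_prop))
    · exact contDiff_const
  have hsupp : Function.support (cutoff k j) ⊆ Set.Icc (1 / (k : ℝ)) (j / k) := by
    intro y hy
    have := cutoff_ne_zero hy
    have hk : (0 : ℝ) < k := by
      rcases (Nat.cast_nonneg (α := ℝ) k).eq_or_lt with hk | hk
      · rw [← hk] at this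
        linarith [this.1]
      · exact hk
    constructor
    · rw [div_le_iff₀ hk]
      linarith
    · rw [le_div_iff₀ hk]
      linarith
  refine ⟨hcont, HasCompactSupport.of_support_subset_isCompact isCompact_Icc hsupp, ?_⟩
  rcases Nat.eq_zero_or_pos k with rfl | hk
  · have : cutoff 0 j = 0 := by
      funext y
      by_contra hy
      have := cutoff_ne_zero hy
      norm_num at this
    simp [this]
  · intro y hy
    have := closure_minimal hsupp isClosed_Icc hy
    exact lt_of_lt_of_le (by positivity) this.1

/-- For `k > 0` this is a difference of two approximate Dirac masses, one near `j / k` and one near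
`0`. -/
theorem neg_deriv_cutoff {k j : ℕ} (hj : 2 ≤ j) (y : ℝ) :
    -deriv (cutoff k j) y =
      k * deriv smoothTransition (k * y - j + 1) - k * deriv smoothTransition (k * y - 1) := by
  have h₁ : HasDerivAt (fun y : ℝ => (k : ℝ) * y - 1) k y := by
    simpa using ((hasDerivAt_id y).const_mul (k : ℝ)).sub_const 1
  have h₂ : HasDerivAt (fun y : ℝ => (k : ℝ) * y - j + 1) k y := by
    simpa using (((hasDerivAt_id y).const_mul (k : ℝ)).sub_const (j : ℝ)).add_const 1
  have h := ((differentiable_smoothTransition _).hasDerivAt.comp y h₁).sub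
    ((differentiable_smoothTransition _).hasDerivAt.comp y h₂)
  have heq : cutoff k j = (smoothTransition ∘ fun y : ℝ => (k : ℝ) * y - 1) -
      (smoothTransition ∘ fun y : ℝ => (k : ℝ) * y - j + 1) := by
    funext z
    simp [cutoff, hj]
  rw [heq, h.deriv]
  ring

theorem integral_scaled_smoothTransition_deriv {k : ℕ} (hk : 0 < k) (c : ℝ) :
    ∫ y : ℝ, k * deriv smoothTransition (k * y - c) = 1 := by
  have hk' : (0 : ℝ) < k := by exact_mod_cast hk
  rw [integral_const_mul, Measure.integral_comp_mul_left (fun y => deriv smoothTransition (y - c)),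
    integral_sub_right_eq_self, integral_smoothTransition_deriv, abs_of_pos (by positivity)]
  simp [hk'.ne']

/-! ### Box increments as limits of the mixed derivative -/

/-- Integrals against probability densities that concentrate at a point converge to the value at
that point. -/
theorem tendsto_integral_of_concentrating {f : (d → ℝ) → ℝ} (hf : Continuous f)
    {ρ : ℕ → (d → ℝ) → ℝ} (p : d → ℝ) (hcont : ∀ k, Continuous (ρ k)) (hnonneg : ∀ k y, 0 ≤ ρ k y)
    (hint : ∀ᶠ k in atTop, ∫ y, ρ k y = 1)
    (hsupp : ∀ r > 0, ∀ᶠ k in atTop, ∀ y, ρ k y ≠ 0 → dist y p < r) :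
    Tendsto (fun k => ∫ y, ρ k y * f y) atTop (𝓝 (f p)) := by
  rw [Metric.tendsto_nhds]
  intro ε hε
  obtain ⟨r, hr, hball⟩ := Metric.continuousAt_iff.1 hf.continuousAt (ε / 2) (half_pos hε)
  filter_upwards [hint, hsupp r hr] with k hk hs
  have hc : HasCompactSupport (ρ k) := HasCompactSupport.of_support_subset_isCompact
    (isCompact_closedBall p r) fun y hy => (hs y hy).le
  have hi : Integrable (ρ k) := (hcont k).integrable_of_hasCompactSupport hc
  have hif : Integrable fun y => ρ k y * f y :=
    ((hcont k).mul hf).integrable_of_hasCompactSupport hc.mul_right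
  have heq : (∫ y, ρ k y * f y) - f p = ∫ y, ρ k y * (f y - f p) := by
    simp only [mul_sub]
    rw [integral_sub hif (hi.mul_const _), integral_mul_const, hk, one_mul]
  rw [Real.dist_eq, heq, ← Real.norm_eq_abs]
  refine lt_of_le_of_lt ?_ (half_lt_self hε)
  calc ‖∫ y, ρ k y * (f y - f p)‖ ≤ ∫ y, ρ k y * (ε / 2) := by
        refine norm_integral_le_of_norm_le (hi.mul_const _) (ae_of_all _ fun y => ?_)
        rw [norm_mul, Real.norm_of_nonneg (hnonneg k y)]
        by_cases hy : ρ k y = 0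
        · simp [hy]
        · exact mul_le_mul_of_nonneg_left (hball (hs y hy)).le (hnonneg k y)
    _ = ε / 2 := by rw [integral_mul_const, hk, one_mul]

/-- The increment of `𝟎^z h` over the box with opposite vertices `0` and `x`. -/
def boxIncrement (d : Finset (Fin n)) (h : (Fin n → ℝ) → ℝ) (x : d → ℝ) : ℝ :=
  ∑ e : Finset d, (-1) ^ (eᶜ).card * zeroOp d h fun i => if i ∈ e then x i else 0

/-- Toggling `i` in `e` leaves the vertex unchanged and reverses the sign. -/
theorem boxIncrement_eq_zero (h : (Fin n → ℝ) → ℝ) {x : d → ℝ} {i : d} (hi : x i = 0) :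
    boxIncrement d h x = 0 := by
  refine Finset.sum_involution (fun e _ => if i ∈ e then e.erase i else insert i e) ?_ ?_ ?_ ?_
  · intro e _
    have hpt : (fun j => if j ∈ (if i ∈ e then e.erase i else insert i e) then x j else 0) =
        fun j => if j ∈ e then x j else 0 := by
      funext j
      rcases eq_or_ne j i with rfl | hj
      · simp [hi]
      · split_ifs <;> simp_all
    rw [hpt, ← add_mul]
    by_cases hie : i ∈ e
    · rw [if_pos hie, Finset.compl_erase, Finset.card_insert_of_notMem (by simpa using hie)]
      ring
    · rw [if_neg hie, Finset.compl_insert]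
      rw [← Finset.card_erase_add_one (s := eᶜ) (by simpa using hie)]
      ring
  · intro e _ _
    split_ifs with hie
    · exact fun h => Finset.notMem_erase i e (h.symm ▸ hie)
    · exact fun h => hie (h ▸ Finset.mem_insert_self i e)
  · intro e _
    exact Finset.mem_univ _
  · intro e _
    by_cases hie : i ∈ e
    · simp [hie]
    · simp [hie]

theorem prod_sub_eq_sum_ite {ι : Type*} [Fintype ι] [DecidableEq ι] (a b : ι → ℝ) :
    ∏ i, (b i - a i) = ∑ e : Finset ι, (-1) ^ (eᶜ).card * ∏ i, if i ∈ e then b i else a i := by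
  simp_rw [sub_eq_add_neg]
  rw [Fintype.prod_add]
  refine Finset.sum_congr rfl fun e _ => ?_
  rw [Finset.prod_neg, Finset.prod_ite]
  have h₁ : (Finset.univ.filter fun i => i ∈ e) = e := by ext; simp
  have h₂ : (Finset.univ.filter fun i => i ∉ e) = eᶜ := by ext; simp
  rw [h₁, h₂]
  ring

/-- The discretization of `x` at scale `1 / k`, truncated at `k`. -/
def level (k : ℕ) (x : ℝ) : ℕ := min ⌊k * x⌋₊ (k * k)

theorem level_le {k : ℕ} {x : ℝ} (hx : 0 ≤ x) : (level k x : ℝ) ≤ k * x :=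
  (Nat.cast_le.2 (min_le_left _ _)).trans (Nat.floor_le (by positivity))

theorem le_level {k : ℕ} {x y : ℝ} (h₁ : k * y + 2 ≤ k * x) (h₂ : y + 1 ≤ k) (hk : 1 ≤ k) :
    k * y + 1 ≤ level k x := by
  have hk' : (1 : ℝ) ≤ k := by exact_mod_cast hk
  rw [level, Nat.cast_min]
  refine le_min ?_ ?_
  · linarith [Nat.lt_floor_add_one ((k : ℝ) * x)]
  · push_cast
    nlinarith

theorem sub_one_le_level {k : ℕ} {x : ℝ} (hk : x ≤ k) : k * x - 1 ≤ level k x := by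
  rw [level, Nat.cast_min]
  refine le_min ?_ ?_
  · linarith [Nat.lt_floor_add_one ((k : ℝ) * x)]
  · push_cast
    nlinarith [Nat.cast_nonneg (α := ℝ) k]

/-- The product of the one-dimensional cutoffs as a test function. -/
def boxTest (d : Finset (Fin n)) (k : ℕ) (j : d → ℕ) : 𝓓(orthant d, ℝ) :=
  prodTest (fun i => cutoff k (j i)) fun i => isCutoff_cutoff k (j i)

/-- Expanding the product of differences of approximate Dirac masses gives one density for each `e`;
it concentrates at the corresponding vertex of the box and carries the sign of that vertex. -/
theorem tendsto_mixedDerivative_boxTest {h : (Fin n → ℝ) → ℝ} (hh : Continuous h) {x : d → ℝ}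
    (hx : ∀ i, 0 ≤ x i) :
    Tendsto (fun k : ℕ => mixedDerivative d h (boxTest d k fun i => level k (x i))) atTop
      (𝓝 (boxIncrement d h x)) := by
  by_cases hzero : ∃ i, x i = 0
  · obtain ⟨i, hi⟩ := hzero
    rw [boxIncrement_eq_zero h hi]
    -- A vanishing coordinate has level `0`, where `cutoff` is zero by default.
    refine tendsto_const_nhds.congr fun k => ?_
    have : boxTest d k (fun i => level k (x i)) = 0 := by
      ext y
      exact Finset.prod_eq_zero (Finset.mem_univ i) (by simp [hi, level, cutoff])
    rw [this, map_zero]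
  · push Not at hzero
    have hpos : ∀ i, 0 < x i := fun i => (hx i).lt_of_ne' (hzero i)
    let a : ℕ → d → ℝ → ℝ := fun k _ y => k * deriv smoothTransition (k * y - 1)
    let b : ℕ → d → ℝ → ℝ := fun k i y =>
      k * deriv smoothTransition (k * y - level k (x i) + 1)
    let ρ : Finset d → ℕ → (d → ℝ) → ℝ := fun e k y =>
      ∏ i, if i ∈ e then b k i (y i) else a k i (y i)
    have hσ := continuous_smoothTransition_deriv
    have hρcont : ∀ e k, Continuous (ρ e k) := by
      intro e k
      refine continuous_finsetProd _ fun i _ => ?_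
      split_ifs
      · exact continuous_const.mul (hσ.comp (by fun_prop))
      · exact continuous_const.mul (hσ.comp (by fun_prop))
    have hρnonneg : ∀ e k y, 0 ≤ ρ e k y := by
      intro e k y
      refine Finset.prod_nonneg fun i _ => ?_
      split_ifs
      · exact mul_nonneg (Nat.cast_nonneg _) (smoothTransition_deriv_nonneg _)
      · exact mul_nonneg (Nat.cast_nonneg _) (smoothTransition_deriv_nonneg _)
    have hρint : ∀ e, ∀ᶠ k in atTop, ∫ y, ρ e k y = 1 := by
      intro e
      filter_upwards [eventually_gt_atTop 0] with k hk
      have := integral_fintype_prod_volume_eq_prod (𝕜 := ℝ)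
        (fun (i : d) (t : ℝ) => if i ∈ e then b k i t else a k i t)
      refine this.trans (Finset.prod_eq_one fun i _ => ?_)
      split_ifs
      · simpa only [b, sub_add] using
          integral_scaled_smoothTransition_deriv hk (level k (x i) - 1)
      · exact integral_scaled_smoothTransition_deriv hk 1
    have hlarge : ∀ᶠ k : ℕ in atTop, ∀ i, x i ≤ k :=
      eventually_all.2 fun i => tendsto_natCast_atTop_atTop.eventually_ge_atTop (x i)
    have hρsupp : ∀ e, ∀ r > 0, ∀ᶠ k in atTop, ∀ y, ρ e k y ≠ 0 →
        dist y (fun i => if i ∈ e then x i else 0) < r := by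
      intro e r hr
      -- On the support each coordinate is within `2 / k` of the vertex: one unit of `1 / k` from
      -- the rounding and one from the width of the transition.
      filter_upwards [hlarge, eventually_gt_atTop 0,
        tendsto_natCast_atTop_atTop.eventually_gt_atTop (2 / r)] with k hk hk0 hkr y hy
      have hk0' : (0 : ℝ) < k := by exact_mod_cast hk0
      rw [div_lt_iff₀ hr] at hkr
      rw [dist_pi_lt_iff hr]
      intro i
      have hi := Finset.prod_ne_zero_iff.1 hy i (Finset.mem_univ i)
      rw [Real.dist_eq]
      refine lt_of_mul_lt_mul_left (lt_of_le_of_lt ?_ hkr) hk0'.le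
      rw [← abs_of_pos hk0', ← abs_mul, abs_le]
      split_ifs at hi ⊢ with hie
      · have h₁ := smoothTransition_deriv_support (right_ne_zero_of_mul hi)
        have h₂ := level_le (k := k) (hx i)
        have h₃ := sub_one_le_level (hk i)
        constructor <;> linarith [h₁.1, h₁.2]
      · have h₁ := smoothTransition_deriv_support (right_ne_zero_of_mul hi)
        constructor <;> linarith [h₁.1, h₁.2]
    have hlim : ∀ e : Finset d, Tendsto (fun k => ∫ y, ρ e k y * zeroOp d h y) atTop
        (𝓝 (zeroOp d h fun i => if i ∈ e then x i else 0)) := fun e =>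
      tendsto_integral_of_concentrating (continuous_zeroOp hh) _ (hρcont e) (hρnonneg e)
        (hρint e) (hρsupp e)
    refine (tendsto_finsetSum Finset.univ fun e _ => (hlim e).const_mul _).congr' ?_
    -- From `k * x i ≥ 3` the level is at least `2`, so the default branch of `cutoff` is not taken.
    have htwo : ∀ᶠ k : ℕ in atTop, ∀ i, 2 ≤ level k (x i) := by
      refine eventually_all.2 fun i => ?_
      filter_upwards [hlarge, tendsto_natCast_atTop_atTop.eventually_ge_atTop (3 / x i)]
        with k hk hk3
      rw [div_le_iff₀ (hpos i)] at hk3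
      have := sub_one_le_level (hk i)
      have : (2 : ℝ) ≤ level k (x i) := by linarith
      exact_mod_cast this
    have hρcomp : ∀ e, ∀ᶠ k in atTop, HasCompactSupport (ρ e k) := by
      intro e
      filter_upwards [hρsupp e 1 one_pos] with k hk
      exact HasCompactSupport.of_support_subset_isCompact (isCompact_closedBall _ 1)
        fun y hy => (hk y hy).le
    filter_upwards [htwo, eventually_all.2 hρcomp] with k hk hcomp
    rw [boxTest, mixedDerivative_prodTest hh]
    simp_rw [neg_deriv_cutoff (hk _)]
    have : ∀ y : d → ℝ, (∏ i, (k * deriv smoothTransition (k * y i - level k (x i) + 1) -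
        k * deriv smoothTransition (k * y i - 1))) * zeroOp d h y =
        ∑ e : Finset d, (-1) ^ (eᶜ).card * (ρ e k y * zeroOp d h y) := by
      intro y
      rw [prod_sub_eq_sum_ite, Finset.sum_mul]
      exact Finset.sum_congr rfl fun e _ => mul_assoc _ _ _
    simp_rw [this]
    rw [integral_finsetSum]
    · simp_rw [integral_const_mul]
    · intro e _
      exact (((hρcont e k).mul (continuous_zeroOp hh)).integrable_of_hasCompactSupport
        (hcomp e).mul_right).const_mul _

/-! ### Near-optimal test functions for the weighted suprema -/

section Expectation

section Suprema

variable {U : Opens (d → ℝ)} {T : 𝓓'(U, ℝ)} {w : (d → ℝ) → ℝ}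

theorem le_toReal_iSup_ofReal {α : Type*} {p : α → Prop} {f : α → ℝ}
    (hfin : ⨆ (a) (_ : p a), ENNReal.ofReal (f a) ≠ ∞) {a : α} (ha : p a) :
    f a ≤ (⨆ (a) (_ : p a), ENNReal.ofReal (f a)).toReal :=
  (ENNReal.ofReal_le_iff_le_toReal hfin).1
    (le_iSup₂ (f := fun (a : α) (_ : p a) => ENNReal.ofReal (f a)) a ha)

/-- The base point `a₀` of value `0` compensates for the clipping of negative values by
`ENNReal.ofReal`. -/
theorem exists_toReal_iSup_ofReal_sub_lt {α : Type*} {p : α → Prop} {f : α → ℝ} {a₀ : α}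
    (h₀ : p a₀) (hf₀ : f a₀ = 0) {δ : ℝ} (hδ : 0 < δ) :
    ∃ a, p a ∧ (⨆ (a) (_ : p a), ENNReal.ofReal (f a)).toReal - δ < f a := by
  by_contra! hcon
  have hnonneg := hcon a₀ h₀
  rw [hf₀] at hnonneg
  have hle := ENNReal.toReal_mono ENNReal.ofReal_ne_top
    (iSup₂_le fun a ha => ENNReal.ofReal_le_ofReal (hcon a ha))
  rw [ENNReal.toReal_ofReal hnonneg] at hle
  linarith

theorem integralPosPart_le_integralVariation :
    integralPosPart T w ≤ integralVariation T w :=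
  iSup₂_le fun φ hφ => le_iSup₂ (f := fun (φ : 𝓓(U, ℝ)) (_ : ∀ y, |φ y| ≤ w y) =>
    ENNReal.ofReal (T φ)) φ fun y => (abs_of_nonneg (hφ y).1).trans_le (hφ y).2

theorem integralPosPart_neg_le_integralVariation :
    integralPosPart (-T) w ≤ integralVariation T w := by
  refine iSup₂_le fun φ hφ => ?_
  have h := le_iSup₂ (f := fun (φ : 𝓓(U, ℝ)) (_ : ∀ y, |φ y| ≤ w y) =>
    ENNReal.ofReal (T φ)) (-φ) fun y => by
      change |-(φ y)| ≤ w y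
      rw [abs_neg]
      exact (abs_of_nonneg (hφ y).1).trans_le (hφ y).2
  rwa [map_neg] at h

end Suprema

variable {Ω : Type*} [MeasurableSpace Ω] {Q : Measure Ω} {X : Ω → Fin n → ℝ}
  {h : (Fin n → ℝ) → ℝ}

theorem tail_nonneg (y : d → ℝ) : 0 ≤ tail Q X d y := measureReal_nonneg

theorem measurableSet_tail (hX : ∀ i, Measurable fun ω => X ω i) (y : d → ℝ) :
    MeasurableSet {ω | ∀ i : d, y i < X ω i} := by
  rw [Set.ofPred_forall]
  exact MeasurableSet.iInter fun i => measurableSet_lt measurable_const (hX i)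

theorem setIntegral_tail_indicator (hX : ∀ i, Measurable fun ω => X ω i) (E : Set Ω)
    (y : d → ℝ) :
    ∫ ω in E, Set.indicator {x : d → ℝ | ∀ i, y i < x i} (1 : (d → ℝ) → ℝ) (fun i => X ω i) ∂Q =
      (Q.restrict E).real {ω | ∀ i : d, y i < X ω i} := by
  rw [← integral_indicator_one (measurableSet_tail hX y)]
  rfl

/-- The shift leaves room `ε` below the tail, which the averaged cutoffs need in order to dominate
`ψ`. The sign `ς` treats `T` and `-T` together. -/
theorem exists_near_optimal_translate (hh : Continuous h) {ς : ℝ} (hς : |ς| = 1)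
    {δ : ℝ} (hδ : 0 < δ) :
    ∃ ε > 0, ∃ ψ : 𝓓(orthant d, ℝ), (∀ y, 0 ≤ ψ y ∧ ψ y ≤ tail Q X d (y + fun _ => ε)) ∧
      (integralPosPart (ς • mixedDerivative d h) (tail Q X d)).toReal - δ <
        ς * mixedDerivative d h ψ := by
  obtain ⟨φ, hφ, hlt⟩ : ∃ φ : 𝓓(orthant d, ℝ), (∀ y, 0 ≤ φ y ∧ φ y ≤ tail Q X d y) ∧
      (integralPosPart (ς • mixedDerivative d h) (tail Q X d)).toReal - δ / 2 <
        (ς • mixedDerivative d h) φ :=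
    exists_toReal_iSup_ofReal_sub_lt (a₀ := (0 : 𝓓(orthant d, ℝ)))
      (fun y => by simpa using tail_nonneg y) (map_zero _) (by positivity)
  obtain ⟨ε, hε, ψ, hψ, hψφ⟩ := exists_translate hh φ (half_pos hδ)
  refine ⟨ε, hε, ψ, fun y => hψ y ▸ hφ _, ?_⟩
  have h₁ : |ς * mixedDerivative d h ψ - ς * mixedDerivative d h φ| < δ / 2 := by
    rwa [← mul_sub, abs_mul, hς, one_mul]
  have h₂ : (ς • mixedDerivative d h) φ = ς * mixedDerivative d h φ := rfl
  linarith [(abs_lt.1 h₁).1]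

variable [IsProbabilityMeasure Q]

theorem tail_antitone : Antitone (tail Q X d) := fun _ _ hyz =>
  measureReal_mono fun _ hω i => (hyz i).trans_lt (hω i)

/-! ### Averages of cutoffs over the discretized law -/

theorem measurable_level (k : ℕ) : Measurable (level k) :=
  (Nat.measurable_floor.comp (measurable_const.mul measurable_id)).min measurable_const

/-- The truncation in `level` leaves finitely many values, so expectations become finite sums and
averages of test functions remain test functions. -/
theorem comp_level_eq_sum {Ω : Type*} (X : Ω → Fin n → ℝ) (k : ℕ) (F : (d → ℕ) → ℝ) (ω : Ω) :
    F (fun i => level k (X ω i)) = ∑ j ∈ Fintype.piFinset fun _ : d => Finset.range (k * k + 1),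
      Set.indicator {ω | (fun i : d => level k (X ω i)) = j} (fun _ => F j) ω := by
  classical
  simp only [Set.indicator_apply, Set.mem_ofPred_eq]
  rw [Finset.sum_ite_eq, if_pos]
  simp only [Fintype.mem_piFinset, Finset.mem_range, level]
  exact fun i => Nat.lt_succ_of_le (min_le_right _ _)

theorem measurable_level_comp (hX : ∀ i, Measurable fun ω => X ω i) (k : ℕ) :
    Measurable fun (ω : Ω) (i : d) => level k (X ω i) :=
  measurable_pi_lambda _ fun i => (measurable_level k).comp (hX i)

theorem integrable_comp_level (hX : ∀ i, Measurable fun ω => X ω i) (k : ℕ)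
    (F : (d → ℕ) → ℝ) (E : Set Ω) :
    Integrable (fun ω => F fun i => level k (X ω i)) (Q.restrict E) := by
  simp_rw [comp_level_eq_sum X k F]
  refine integrable_finsetSum _ fun j _ => ?_
  exact (integrable_const (F j)).indicator (measurable_level_comp hX k (measurableSet_singleton j))

theorem setIntegral_comp_level (hX : ∀ i, Measurable fun ω => X ω i) (k : ℕ)
    (F : (d → ℕ) → ℝ) (E : Set Ω) :
    ∫ ω in E, F (fun i => level k (X ω i)) ∂Q =
      ∑ j ∈ Fintype.piFinset fun _ : d => Finset.range (k * k + 1),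
        (Q.restrict E).real {ω | (fun i : d => level k (X ω i)) = j} * F j := by
  simp_rw [comp_level_eq_sum X k F]
  have hmeas : ∀ j : d → ℕ, MeasurableSet {ω | (fun i : d => level k (X ω i)) = j} := fun j =>
    measurable_level_comp hX k (measurableSet_singleton j)
  rw [integral_finsetSum]
  · refine Finset.sum_congr rfl fun j _ => ?_
    exact integral_indicator_const (F j) (hmeas j)
  · exact fun j _ => (integrable_const (F j)).indicator (hmeas j)

/-- Signed averages of the test functions `boxTest` over the discretized law of `X`. -/
theorem exists_average_boxTest (hX : ∀ i, Measurable fun ω => X ω i) (k : ℕ) (s : (d → ℕ) → ℝ)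
    (E : Set Ω) (T : 𝓓'(orthant d, ℝ)) :
    ∃ φ : 𝓓(orthant d, ℝ),
      (∀ y, φ y = ∫ ω in E, s (fun i => level k (X ω i)) *
        boxTest d k (fun i => level k (X ω i)) y ∂Q) ∧
      T φ = ∫ ω in E, s (fun i => level k (X ω i)) *
        T (boxTest d k fun i => level k (X ω i)) ∂Q := by
  refine ⟨∑ j ∈ Fintype.piFinset fun _ : d => Finset.range (k * k + 1),
    (Q.restrict E).real {ω | (fun i : d => level k (X ω i)) = j} • s j • boxTest d k j,
    fun y => ?_, ?_⟩
  · rw [setIntegral_comp_level hX k (fun j => s j * boxTest d k j y)]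
    -- Evaluation at `y` is a distribution, hence commutes with the finite sum.
    have := map_sum (Distribution.delta y : 𝓓'(orthant d, ℝ))
      (fun j => (Q.restrict E).real {ω | (fun i : d => level k (X ω i)) = j} •
        s j • boxTest d k j) (Fintype.piFinset fun _ : d => Finset.range (k * k + 1))
    simpa only [map_smul, Distribution.delta_apply, smul_eq_mul] using this
  · rw [setIntegral_comp_level hX k (fun j => s j * T (boxTest d k j))]
    simp [map_sum, map_smul]

theorem boxTest_nonneg (k : ℕ) (j : d → ℕ) (y : d → ℝ) : 0 ≤ boxTest d k j y :=
  Finset.prod_nonneg fun _ _ => cutoff_nonneg _ _ _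

theorem boxTest_le_one (k : ℕ) (j : d → ℕ) (y : d → ℝ) : boxTest d k j y ≤ 1 :=
  Finset.prod_le_one (fun _ _ => cutoff_nonneg _ _ _) fun _ _ => cutoff_le_one _ _ _

theorem boxTest_level_le_indicator (k : ℕ) {x : d → ℝ} (hx : ∀ i, 0 ≤ x i) (y : d → ℝ) :
    boxTest d k (fun i => level k (x i)) y ≤ Set.indicator {x | ∀ i, y i < x i} 1 x := by
  by_cases hyx : x ∈ {x : d → ℝ | ∀ i, y i < x i}
  · rw [Set.indicator_of_mem hyx]
    exact boxTest_le_one _ _ _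
  · rw [Set.indicator_of_notMem hyx]
    simp only [Set.mem_ofPred_eq, not_forall, not_lt] at hyx
    obtain ⟨i, hi⟩ := hyx
    refine (Finset.prod_eq_zero (Finset.mem_univ i) ?_).le
    by_contra hne
    have h₁ := (cutoff_ne_zero hne).2
    have h₂ := level_le (k := k) (hx i)
    have h₃ := mul_le_mul_of_nonneg_left hi (Nat.cast_nonneg (α := ℝ) k)
    linarith

/-- Rounding costs less than `1 / k` and the descent of the cutoff another `1 / k`; the margin `ε ≥
2 / k` absorbs both. -/
theorem indicator_le_boxTest_level {k : ℕ} {ε : ℝ} {x y : d → ℝ} (hk : 1 ≤ k) (hε : 2 ≤ k * ε)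
    (hy : ∀ i, 2 ≤ k * y i ∧ y i + 1 ≤ k) :
    Set.indicator {x | ∀ i, y i + ε < x i} 1 x ≤ boxTest d k (fun i => level k (x i)) y := by
  by_cases hyx : x ∈ {x : d → ℝ | ∀ i, y i + ε < x i}
  · rw [Set.indicator_of_mem hyx]
    refine (Finset.prod_eq_one fun i _ => cutoff_eq_one (hy i).1 (le_level ?_ (hy i).2 hk)).ge
    have := mul_le_mul_of_nonneg_left (hyx i).le (Nat.cast_nonneg (α := ℝ) k)
    linarith
  · rw [Set.indicator_of_notMem hyx]
    exact boxTest_nonneg _ _ _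

theorem integrable_tail_indicator (hX : ∀ i, Measurable fun ω => X ω i) (E : Set Ω)
    (y : d → ℝ) :
    Integrable (fun ω => Set.indicator {x : d → ℝ | ∀ i, y i < x i} (1 : (d → ℝ) → ℝ)
      (fun i => X ω i)) (Q.restrict E) :=
  (integrable_const (1 : ℝ)).indicator (measurableSet_tail hX y)

theorem abs_average_boxTest_le (hX : ∀ i, Measurable fun ω => X ω i) (hX₀ : ∀ ω i, 0 ≤ X ω i)
    (k : ℕ) {s : (d → ℕ) → ℝ} (hs : ∀ j, |s j| ≤ 1) (E : Set Ω) (y : d → ℝ) :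
    |∫ ω in E, s (fun i => level k (X ω i)) * boxTest d k (fun i => level k (X ω i)) y ∂Q| ≤
      (Q.restrict E).real {ω | ∀ i : d, y i < X ω i} := by
  rw [← setIntegral_tail_indicator hX, ← Real.norm_eq_abs]
  refine norm_integral_le_of_norm_le (integrable_tail_indicator hX E y) (ae_of_all _ fun ω => ?_)
  refine le_trans ?_ (boxTest_level_le_indicator k (fun i => hX₀ ω i) y)
  rw [norm_mul, Real.norm_of_nonneg (boxTest_nonneg _ _ _)]
  exact mul_le_of_le_one_left (boxTest_nonneg _ _ _) (hs _)

theorem tail_le_average_boxTest (hX : ∀ i, Measurable fun ω => X ω i) {k : ℕ} {ε : ℝ}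
    {y : d → ℝ} (hk : 1 ≤ k) (hε : 2 ≤ k * ε) (hy : ∀ i, 2 ≤ k * y i ∧ y i + 1 ≤ k) :
    tail Q X d (y + fun _ => ε) ≤ ∫ ω, boxTest d k (fun i => level k (X ω i)) y ∂Q := by
  have h₁ := setIntegral_tail_indicator (Q := Q) hX Set.univ (y + fun _ => ε)
  rw [Measure.restrict_univ] at h₁
  rw [tail, ← h₁]
  refine integral_mono ?_ ?_ fun ω => indicator_le_boxTest_level hk hε hy
  · have := integrable_tail_indicator (Q := Q) hX Set.univ (y + fun _ => ε)
    rwa [Measure.restrict_univ] at this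
  · simpa using integrable_comp_level (Q := Q) hX k (fun j => boxTest d k j y) Set.univ

/-- Near any point of the support there is `y'` with `ψ y' ≠ 0`, so the tail at `y' + ε` is
positive; by monotonicity it bounds the tail from below on a ball, and compactness makes the bound
uniform. -/
theorem exists_pos_le_tail_of_translate {ε : ℝ} (hε : 0 < ε) {ψ : 𝓓(orthant d, ℝ)}
    (hψ : ∀ y, |ψ y| ≤ tail Q X d (y + fun _ => ε)) :
    ∃ c > 0, ∀ y ∈ tsupport ψ, c ≤ tail Q X d y := by
  refine ψ.hasCompactSupport.isCompact.induction_on (p := fun s => ∃ c > 0, ∀ y ∈ s,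
    c ≤ tail Q X d y) ⟨1, one_pos, by simp⟩ ?_ ?_ ?_
  · rintro s t hst ⟨c, hc, h⟩
    exact ⟨c, hc, fun y hy => h y (hst hy)⟩
  · rintro s t ⟨c, hc, h⟩ ⟨c', hc', h'⟩
    refine ⟨min c c', lt_min hc hc', fun y hy => hy.elim (fun hy => ?_) fun hy => ?_⟩
    · exact (min_le_left _ _).trans (h y hy)
    · exact (min_le_right _ _).trans (h' y hy)
  · intro y hy
    obtain ⟨y', hy', hdist⟩ := Metric.mem_closure_iff.1 hy (ε / 2) (half_pos hε)
    refine ⟨Metric.ball y (ε / 2), mem_nhdsWithin_of_mem_nhds (Metric.ball_mem_nhds y (half_pos hε)),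
      tail Q X d (y' + fun _ => ε), (abs_pos.2 hy').trans_le (hψ y'), fun z hz => ?_⟩
    refine tail_antitone fun i => ?_
    have h₁ := abs_lt.1 ((Real.dist_eq _ _ ▸ dist_le_pi_dist y y' i).trans_lt hdist)
    have h₂ := abs_lt.1 ((Real.dist_eq _ _ ▸ dist_le_pi_dist z y i).trans_lt hz)
    simp only [Pi.add_apply]
    linarith [h₁.2, h₂.2]

theorem eventually_bounds_of_compact {K : Set (d → ℝ)} (hK : IsCompact K)
    (hsub : K ⊆ orthant d) :
    ∀ᶠ k : ℕ in atTop, ∀ y ∈ K, ∀ i, 2 ≤ k * y i ∧ y i + 1 ≤ k := by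
  refine hK.induction_on (p := fun s => ∀ᶠ k : ℕ in atTop, ∀ y ∈ s, ∀ i,
    2 ≤ k * y i ∧ y i + 1 ≤ k) (by simp) ?_ ?_ ?_
  · intro s t hst h
    filter_upwards [h] with k hk y hy using hk y (hst hy)
  · intro s t hs ht
    filter_upwards [hs, ht] with k hks hkt y hy using hy.elim (hks y) (hkt y)
  · intro y hy
    refine ⟨{z | ∀ i, y i / 2 < z i ∧ z i < y i + 1}, mem_nhdsWithin_of_mem_nhds ?_, ?_⟩
    · refine eventually_all.2 fun i => ?_
      have hi : 0 < y i := hsub hy i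
      exact ((continuous_apply i).continuousAt.eventually (lt_mem_nhds (half_lt_self hi))).and
        ((continuous_apply i).continuousAt.eventually (gt_mem_nhds (lt_add_one (y i))))
    · have : ∀ᶠ k : ℕ in atTop, ∀ i, 4 / y i ≤ k ∧ y i + 2 ≤ k := eventually_all.2 fun i =>
        (tendsto_natCast_atTop_atTop.eventually_ge_atTop _).and
          (tendsto_natCast_atTop_atTop.eventually_ge_atTop _)
      filter_upwards [this] with k hk z hz i
      have hi : 0 < y i := hsub hy i
      have h₁ := (div_le_iff₀ hi).1 (hk i).1
      have h₂ := mul_le_mul_of_nonneg_left (hz i).1.le (Nat.cast_nonneg (α := ℝ) k)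
      exact ⟨by linarith, by linarith [(hk i).2, (hz i).2]⟩

theorem eventually_le_average_boxTest (hX : ∀ i, Measurable fun ω => X ω i) {ε : ℝ} (hε : 0 < ε)
    {ψ : 𝓓(orthant d, ℝ)} (hψ : ∀ y, ψ y ≤ tail Q X d (y + fun _ => ε)) :
    ∀ᶠ k : ℕ in atTop, ∀ y, ψ y ≤ ∫ ω, boxTest d k (fun i => level k (X ω i)) y ∂Q := by
  filter_upwards [eventually_bounds_of_compact ψ.hasCompactSupport.isCompact ψ.tsupport_subset,
    eventually_ge_atTop 1, tendsto_natCast_atTop_atTop.eventually_ge_atTop (2 / ε)]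
    with k hk hk₁ hkε y
  by_cases hy : y ∈ tsupport ψ
  · exact (hψ y).trans (tail_le_average_boxTest hX hk₁ ((div_le_iff₀ hε).1 hkε) (hk y hy))
  · rw [image_eq_zero_of_notMem_tsupport hy]
    exact integral_nonneg fun ω => boxTest_nonneg _ _ _

/-! ### Uniform integrability and convergence of expectations -/

/-- If the weight `tail` has finite integral against the variation of the mixed derivative, then
the contribution of events of small probability is small. -/
theorem exists_small_event_bound (hh : Continuous h) (hX : ∀ i, Measurable fun ω => X ω i)
    (hA : absA Q X d h < ∞) {δ : ℝ} (hδ : 0 < δ) :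
    ∃ κ > 0, ∀ E : Set Ω, MeasurableSet E → Q.real E ≤ κ → ∀ φ : 𝓓(orthant d, ℝ),
      (∀ y, |φ y| ≤ (Q.restrict E).real {ω | ∀ i : d, y i < X ω i}) →
        mixedDerivative d h φ ≤ δ := by
  set V := (absA Q X d h).toReal with hV
  have hV₀ : 0 ≤ V := ENNReal.toReal_nonneg
  obtain ⟨φ₀, hφ₀, hVφ₀⟩ : ∃ φ : 𝓓(orthant d, ℝ), (∀ y, |φ y| ≤ tail Q X d y) ∧
      V - δ / 4 < mixedDerivative d h φ :=
    exists_toReal_iSup_ofReal_sub_lt (a₀ := (0 : 𝓓(orthant d, ℝ)))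
      (fun y => by simpa using tail_nonneg y) (map_zero _) (by positivity)
  obtain ⟨ε, hε, ψ, hψ, hψφ₀⟩ := exists_translate hh φ₀ (show 0 < δ / 4 by positivity)
  have hψtail : ∀ y, |ψ y| ≤ tail Q X d (y + fun _ => ε) := fun y => hψ y ▸ hφ₀ _
  obtain ⟨c, hc, hcψ⟩ := exists_pos_le_tail_of_translate hε hψtail
  have hψV : V - δ / 2 < mixedDerivative d h ψ := by
    have := abs_lt.1 hψφ₀
    linarith [this.1]
  have hψle : ∀ y, |ψ y| ≤ tail Q X d y := fun y =>
    (hψtail y).trans (tail_antitone fun i => by simp [hε.le])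
  have hψV' : mixedDerivative d h ψ ≤ V := le_toReal_iSup_ofReal hA.ne hψle
  -- Chosen so that shrinking `ψ` by the factor `1 - η` costs at most `δ / 2`; `V + 1` avoids
  -- dividing by zero.
  set η := min 1 (δ / (2 * (V + 1))) with hη
  have hη₀ : 0 < η := lt_min one_pos (by positivity)
  have hη₁ : η ≤ 1 := min_le_left _ _
  have hηV : η * V ≤ δ / 2 := by
    have h₁ : η * (V + 1) ≤ δ / (2 * (V + 1)) * (V + 1) :=
      mul_le_mul_of_nonneg_right (min_le_right _ _) (by positivity)
    have h₂ : δ / (2 * (V + 1)) * (V + 1) = δ / 2 := by field_simp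
    linarith
  refine ⟨η * c, by positivity, fun E hE hQE φ hφ => ?_⟩
  -- On the support of `ψ` the shrinking frees `η * tail ≥ η * c ≥ Q(E)`, so `(1 - η) • ψ` fits into
  -- the part of the tail outside `E` and `φ` into the part inside. Optimality of `V` then leaves
  -- little for `φ`.
  have hsum : ∀ y, |(φ + (1 - η) • ψ) y| ≤ tail Q X d y := by
    intro y
    change |φ y + (1 - η) * ψ y| ≤ _
    set S := {ω | ∀ i : d, y i < X ω i} with hS
    have hSm : MeasurableSet S := measurableSet_tail hX y
    have hrestrict : (Q.restrict E).real S = Q.real (S ∩ E) :=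
      measureReal_restrict_apply hSm
    have hsplit : Q.real (S ∩ E) + Q.real (S \ E) = tail Q X d y :=
      measureReal_inter_add_sdiff hE
    have hinter : Q.real (S ∩ E) ≤ Q.real E := measureReal_mono Set.inter_subset_right
    have hψy : |(1 - η) * ψ y| ≤ Q.real (S \ E) := by
      by_cases hy : y ∈ tsupport ψ
      · rw [abs_mul, abs_of_nonneg (by linarith)]
        have h₁ := mul_le_mul_of_nonneg_left (hψle y) (show 0 ≤ 1 - η by linarith)
        have h₂ := mul_le_mul_of_nonneg_left (hcψ y hy) hη₀.le
        linarith
      · rw [image_eq_zero_of_notMem_tsupport hy]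
        simp
    have := hφ y
    calc |φ y + (1 - η) * ψ y| ≤ |φ y| + |(1 - η) * ψ y| := abs_add_le _ _
      _ ≤ Q.real (S ∩ E) + Q.real (S \ E) := add_le_add (hrestrict ▸ this) hψy
      _ = _ := hsplit
  have hle : mixedDerivative d h (φ + (1 - η) • ψ) ≤ V := le_toReal_iSup_ofReal hA.ne hsum
  rw [map_add, map_smul, smul_eq_mul] at hle
  have := mul_le_mul_of_nonneg_left hψV' hη₀.le
  linarith

/-- The average `φ` satisfies `ψ ≤ φ ≤ tail`, so `φ - ψ` competes in the supremum for `-T`; this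
bounds `T φ` from below. Exchanging the roles of `T` and `-T`, through `ψ'`, bounds it from above.
-/
theorem tendsto_integral_boxTest (hh : Continuous h) (hX : ∀ i, Measurable fun ω => X ω i)
    (hX₀ : ∀ ω i, 0 ≤ X ω i) (hA : absA Q X d h < ∞) :
    Tendsto (fun k : ℕ => ∫ ω, mixedDerivative d h (boxTest d k fun i => level k (X ω i)) ∂Q)
      atTop (𝓝 (A Q X d h)) := by
  have hP : integralPosPart (mixedDerivative d h) (tail Q X d) ≠ ∞ :=
    (integralPosPart_le_integralVariation.trans_lt hA).ne
  have hN : integralPosPart (-mixedDerivative d h) (tail Q X d) ≠ ∞ :=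
    (integralPosPart_neg_le_integralVariation.trans_lt hA).ne
  rw [Metric.tendsto_nhds]
  intro δ hδ
  obtain ⟨ε, hε, ψ, hψ, hlt⟩ :=
    exists_near_optimal_translate (Q := Q) (X := X) (d := d) hh (ς := 1) (by simp) hδ
  obtain ⟨ε', hε', ψ', hψ', hlt'⟩ :=
    exists_near_optimal_translate (Q := Q) (X := X) (d := d) hh (ς := -1) (by simp) hδ
  rw [one_smul, one_mul] at hlt
  rw [neg_one_smul, neg_one_mul] at hlt'
  filter_upwards [eventually_le_average_boxTest hX hε fun y => (hψ y).2,
    eventually_le_average_boxTest hX hε' fun y => (hψ' y).2] with k hk hk'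
  obtain ⟨φ, hφ, hTφ⟩ := exists_average_boxTest (Q := Q) hX k (fun _ => 1) Set.univ
    (mixedDerivative d h)
  simp only [one_mul, Measure.restrict_univ] at hφ hTφ
  have hφtail : ∀ y, φ y ≤ tail Q X d y := fun y => by
    have := abs_average_boxTest_le (Q := Q) hX hX₀ k (s := fun _ => 1) (by simp) Set.univ y
    simp only [one_mul, Measure.restrict_univ, ← hφ] at this
    exact (le_abs_self _).trans this
  rw [← hTφ, Real.dist_eq, abs_lt]
  have h₁ : -mixedDerivative d h (φ - ψ) ≤
      (integralPosPart (-mixedDerivative d h) (tail Q X d)).toReal :=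
    le_toReal_iSup_ofReal (f := fun φ => (-mixedDerivative d h) φ) hN (a := φ - ψ) fun y => by
      change 0 ≤ φ y - ψ y ∧ φ y - ψ y ≤ _
      have := hk y
      rw [← hφ] at this
      exact ⟨by linarith, by linarith [hφtail y, (hψ y).1]⟩
  have h₂ : mixedDerivative d h (φ - ψ') ≤
      (integralPosPart (mixedDerivative d h) (tail Q X d)).toReal :=
    le_toReal_iSup_ofReal (f := fun φ => (mixedDerivative d h) φ) hP (a := φ - ψ') fun y => by
      change 0 ≤ φ y - ψ' y ∧ φ y - ψ' y ≤ _
      have := hk' y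
      rw [← hφ] at this
      exact ⟨by linarith, by linarith [hφtail y, (hψ' y).1]⟩
  rw [map_sub] at h₁ h₂
  unfold A integralAgainst
  constructor <;> linarith

/-- Weighting each cutoff by the sign of its image under `T` turns an `L¹` norm into the value of
`T` at one test function, to which the bounds on the variation apply. -/
theorem setIntegral_abs_boxTest_eq (hX : ∀ i, Measurable fun ω => X ω i)
    (hX₀ : ∀ ω i, 0 ≤ X ω i) (k : ℕ) (E : Set Ω) (T : 𝓓'(orthant d, ℝ)) :
    ∃ φ : 𝓓(orthant d, ℝ), (∀ y, |φ y| ≤ (Q.restrict E).real {ω | ∀ i : d, y i < X ω i}) ∧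
      T φ = ∫ ω in E, |T (boxTest d k fun i => level k (X ω i))| ∂Q := by
  obtain ⟨φ, hφ, hTφ⟩ := exists_average_boxTest (Q := Q) hX k
    (fun j => SignType.sign (T (boxTest d k j))) E T
  refine ⟨φ, fun y => ?_, ?_⟩
  · rw [hφ]
    refine abs_average_boxTest_le hX hX₀ k (s := fun j => SignType.sign (T (boxTest d k j)))
      (fun j => ?_) E y
    cases SignType.sign (T (boxTest d k j)) <;> simp
  · simp only [sign_mul_self] at hTφ
    exact hTφ

theorem eLpNorm_indicator_boxTest (hX : ∀ i, Measurable fun ω => X ω i) (k : ℕ) {E : Set Ω}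
    (hE : MeasurableSet E) (T : 𝓓'(orthant d, ℝ)) :
    eLpNorm (E.indicator fun ω => T (boxTest d k fun i => level k (X ω i))) 1 Q =
      ENNReal.ofReal (∫ ω in E, |T (boxTest d k fun i => level k (X ω i))| ∂Q) := by
  rw [eLpNorm_indicator_eq_eLpNorm_restrict hE, eLpNorm_one_eq_lintegral_enorm,
    ← ofReal_integral_norm_eq_lintegral_enorm
      (integrable_comp_level hX k (fun j => T (boxTest d k j)) E)]
  rfl

theorem uniformIntegrable_boxTest (hh : Continuous h) (hX : ∀ i, Measurable fun ω => X ω i)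
    (hX₀ : ∀ ω i, 0 ≤ X ω i) (hA : absA Q X d h < ∞) :
    UniformIntegrable (fun (k : ℕ) ω => mixedDerivative d h (boxTest d k fun i => level k (X ω i)))
      1 Q := by
  refine ⟨fun k => ?_, fun δ hδ => ?_, (absA Q X d h).toNNReal, fun k => ?_⟩
  · have := integrable_comp_level (Q := Q) hX k (fun j => mixedDerivative d h (boxTest d k j))
      Set.univ
    rw [Measure.restrict_univ] at this
    exact this.aestronglyMeasurable
  · obtain ⟨κ, hκ, hbound⟩ := exists_small_event_bound hh hX hA hδ
    refine ⟨κ, hκ, fun k E hE hQE => ?_⟩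
    rw [eLpNorm_indicator_boxTest hX k hE]
    obtain ⟨φ, hφ, hTφ⟩ := setIntegral_abs_boxTest_eq (Q := Q) hX hX₀ k E (mixedDerivative d h)
    rw [← hTφ]
    exact ENNReal.ofReal_le_ofReal
      (hbound E hE (ENNReal.toReal_le_of_le_ofReal hκ.le hQE) φ hφ)
  · have := eLpNorm_indicator_boxTest (Q := Q) hX k MeasurableSet.univ (mixedDerivative d h)
    rw [Set.indicator_univ] at this
    rw [this, ENNReal.coe_toNNReal hA.ne]
    obtain ⟨φ, hφ, hTφ⟩ :=
      setIntegral_abs_boxTest_eq (Q := Q) hX hX₀ k Set.univ (mixedDerivative d h)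
    rw [← hTφ]
    rw [Measure.restrict_univ] at hφ
    exact le_iSup₂ (f := fun (φ : 𝓓(orthant d, ℝ)) (_ : ∀ y, |φ y| ≤ tail Q X d y) =>
      ENNReal.ofReal (mixedDerivative d h φ)) φ hφ

/-- The expectation of the increment of `𝟎^z h` over the random box `(0, X)` is the integral of
the joint tail against the mixed derivative. -/
theorem integral_boxIncrement (hh : Continuous h) (hX : ∀ i, Measurable fun ω => X ω i)
    (hX₀ : ∀ ω i, 0 ≤ X ω i) (hA : absA Q X d h < ∞) :
    Integrable (fun ω => boxIncrement d h fun i => X ω i) Q ∧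
      ∫ ω, boxIncrement d h (fun i => X ω i) ∂Q = A Q X d h := by
  have hUI := uniformIntegrable_boxTest hh hX hX₀ hA
  have hlim : ∀ᵐ ω ∂Q, Tendsto (fun k : ℕ => mixedDerivative d h
      (boxTest d k fun i => level k (X ω i))) atTop (𝓝 (boxIncrement d h fun i => X ω i)) :=
    ae_of_all _ fun ω => tendsto_mixedDerivative_boxTest hh fun i => hX₀ ω i
  have hint := hUI.integrable_of_ae_tendsto hlim
  refine ⟨hint, ?_⟩
  -- Vitali's convergence theorem; the expectations then have two limits, which must agree.
  have hL1 := tendsto_Lp_finite_of_tendsto_ae le_rfl ENNReal.one_ne_top hUI.1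
    (memLp_one_iff_integrable.2 hint) hUI.2.1 hlim
  refine tendsto_nhds_unique (tendsto_integral_of_L1' _ hint.1 (Eventually.of_forall fun k => ?_)
    hL1) (tendsto_integral_boxTest hh hX hX₀ hA)
  have := integrable_comp_level (Q := Q) hX k (fun j => mixedDerivative d h (boxTest d k j))
    Set.univ
  rwa [Measure.restrict_univ] at this

end Expectation

/-! ### Inclusion-exclusion over the faces of the box -/

theorem boxIncrement_eq_sum_powerset (d : Finset (Fin n)) (h : (Fin n → ℝ) → ℝ) (x : Fin n → ℝ) :
    boxIncrement d h (fun i => x i) =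
      ∑ e ∈ d.powerset, (-1) ^ (d.card - e.card) * h fun i => if i ∈ e then x i else 0 := by
  refine Finset.sum_nbij' (fun e => e.map (Function.Embedding.subtype _))
    (fun e => e.subtype (· ∈ d)) ?_ ?_ ?_ ?_ ?_
  · intro e _
    rw [Finset.mem_powerset]
    intro i hi
    obtain ⟨j, -, rfl⟩ := Finset.mem_map.1 hi
    exact j.2
  · exact fun e _ => Finset.mem_univ _
  · intro e _
    ext i
    simp
  · intro e he
    rw [Finset.mem_powerset] at he
    exact Finset.subtype_map_of_mem he
  · intro e _
    rw [Finset.card_map, Finset.card_compl, Fintype.card_coe]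
    refine congrArg _ (congrArg h (funext fun i => ?_))
    by_cases hi : i ∈ d <;> simp [extendZero, hi]

/-- Removing `e` maps the supersets of `e` onto the subsets of its complement, whose alternating
count vanishes unless the complement is empty. -/
theorem sum_superset_neg_one_pow {ι : Type*} [Fintype ι] [DecidableEq ι] (e : Finset ι) :
    (∑ d : Finset ι with e ⊆ d, (-1 : ℝ) ^ (d.card - e.card)) =
      if e = Finset.univ then 1 else 0 := by
  have h : (∑ d : Finset ι with e ⊆ d, (-1 : ℝ) ^ (d.card - e.card)) =
      ∑ s ∈ eᶜ.powerset, (-1 : ℝ) ^ s.card := by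
    refine Finset.sum_nbij' (fun d => d \ e) (fun s => s ∪ e) ?_ ?_ ?_ ?_ ?_
    · intro d _
      rw [Finset.mem_powerset]
      intro i hi
      simpa using (Finset.mem_sdiff.1 hi).2
    · intro s _
      simp
    · intro d hd
      exact Finset.sdiff_union_of_subset (Finset.mem_filter.1 hd).2
    · intro s hs
      rw [Finset.union_sdiff_right]
      exact Finset.sdiff_eq_self_of_disjoint
        (Finset.subset_compl_iff_disjoint_right.1 (Finset.mem_powerset.1 hs))
    · intro d hd
      rw [Finset.card_sdiff_of_subset (Finset.mem_filter.1 hd).2]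
  have hcast := congrArg (Int.cast : ℤ → ℝ) (Finset.sum_powerset_neg_one_pow_card (x := eᶜ))
  push_cast at hcast
  rw [h, hcast]
  simp

/-- A function is the sum of its increments over the faces of the box from `0` to `x`. -/
theorem sum_boxIncrement (h : (Fin n → ℝ) → ℝ) (x : Fin n → ℝ) :
    ∑ d : Finset (Fin n), boxIncrement d h (fun i => x i) = h x := by
  simp_rw [boxIncrement_eq_sum_powerset]
  rw [Finset.sum_comm' (t' := Finset.univ) (s' := fun e => Finset.univ.filter fun d => e ⊆ d)
    (by simp)]
  simp_rw [← Finset.sum_mul, sum_superset_neg_one_pow]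
  simp

/-! ### Reduction to a globally continuous payoff and a measurable nonnegative vector -/

theorem extendZero_nonneg {y : d → ℝ} (hy : y ∈ orthant d) (i : Fin n) : 0 ≤ extendZero d y i := by
  unfold extendZero
  split_ifs with hi
  · exact (hy ⟨i, hi⟩).le
  · exact le_rfl

theorem mixedDerivative_congr {h h' : (Fin n → ℝ) → ℝ} (heq : ∀ x, (∀ i, 0 ≤ x i) → h x = h' x)
    (d : Finset (Fin n)) : mixedDerivative d h = mixedDerivative d h' := by
  unfold mixedDerivative
  rw [regularDistribution_congr (g := zeroOp d h) (g' := zeroOp d h')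
    fun y hy => heq _ (extendZero_nonneg hy)]

theorem tail_congr {Ω : Type*} [MeasurableSpace Ω] {Q : Measure Ω} {X X' : Ω → Fin n → ℝ}
    (hX : X =ᵐ[Q] X') (d : Finset (Fin n)) : tail Q X d = tail Q X' d := by
  funext y
  refine measureReal_congr ?_
  filter_upwards [hX] with ω hω
  change (∀ i : d, y i < X ω i) = ∀ i : d, y i < X' ω i
  rw [hω]

/-- The pricing formula for a continuous payoff on the whole space and a nonnegative measurable
random vector. -/
theorem integral_eq_sum_A {Ω : Type*} [MeasurableSpace Ω] {Q : Measure Ω} [IsProbabilityMeasure Q]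
    {X : Ω → Fin n → ℝ} {h : (Fin n → ℝ) → ℝ} (hh : Continuous h)
    (hX : ∀ i, Measurable fun ω => X ω i) (hX₀ : ∀ ω i, 0 ≤ X ω i)
    (hA : ∀ d, absA Q X d h < ∞) :
    Integrable (fun ω => h (X ω)) Q ∧
      ∫ ω, h (X ω) ∂Q = ∑ d : Finset (Fin n), A Q X d h := by
  have hbox := fun d => integral_boxIncrement hh hX hX₀ (hA d)
  simp_rw [← sum_boxIncrement h]
  refine ⟨integrable_finsetSum _ fun d _ => (hbox d).1, ?_⟩
  rw [integral_finsetSum _ fun d _ => (hbox d).1]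
  exact Finset.sum_congr rfl fun d _ => (hbox d).2

end

end Pricing

theorem mainTheorem2 {Ω : Type*} [MeasurableSpace Ω] (Q : Measure Ω) [IsProbabilityMeasure Q]
    (n : ℕ) (X : ℝ≥0 → Ω → Fin n → ℝ) (T : ℝ≥0)
    (hX_int : ∀ i, Integrable (fun ω => X T ω i) Q)
    (hX_nonneg : ∀ i, ∀ᵐ ω ∂Q, 0 ≤ X T ω i)
    (B : ℝ≥0 → ℝ) (hB_mono : Monotone B) (hB_zero : B 0 = 1)
    (h : (Fin n → ℝ) → ℝ) (hh : ContinuousOn h {x | ∀ i, 0 ≤ x i})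
    (hA : ∀ d : Finset (Fin n), Pricing.absA Q (X T) d h < ∞) :
    Integrable (fun ω => h (X T ω)) Q ∧
      Pricing.price Q (B T) (X T) h = (B T)⁻¹ * ∑ d : Finset (Fin n), Pricing.A Q (X T) d h := by
  -- Both functionals depend only on `h` on the closed orthant and on `X T` up to null sets. So `X
  -- T` may be replaced by a measurable version clipped at `0`, and `h` by its composition with the
  -- positive part, which is continuous everywhere.
  let Y : Ω → Fin n → ℝ := fun ω i => max ((hX_int i).1.aemeasurable.mk _ ω) 0
  let g : (Fin n → ℝ) → ℝ := fun x => h fun i => max (x i) 0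
  have hY : ∀ i, Measurable fun ω => Y ω i := fun i =>
    (hX_int i).1.aemeasurable.measurable_mk.max measurable_const
  have hY₀ : ∀ ω i, 0 ≤ Y ω i := fun ω i => le_max_right _ _
  have hXY : X T =ᵐ[Q] Y := by
    filter_upwards [ae_all_iff.2 hX_nonneg,
      ae_all_iff.2 fun i => (hX_int i).1.aemeasurable.ae_eq_mk] with ω h₀ hmk
    funext i
    simp only [Y]
    rw [← hmk i, max_eq_left (h₀ i)]
  have hg : Continuous g := hh.comp_continuous (by fun_prop) fun x i => le_max_right _ _
  have hgh : ∀ x : Fin n → ℝ, (∀ i, 0 ≤ x i) → h x = g x := fun x hx => by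
    simp only [g, max_eq_left (hx _)]
  have habs : ∀ d, Pricing.absA Q (X T) d h = Pricing.absA Q Y d g := fun d => by
    rw [Pricing.absA, Pricing.absA, Pricing.mixedDerivative_congr hgh, Pricing.tail_congr hXY]
  have hAeq : ∀ d, Pricing.A Q (X T) d h = Pricing.A Q Y d g := fun d => by
    rw [Pricing.A, Pricing.A, Pricing.mixedDerivative_congr hgh, Pricing.tail_congr hXY]
  have hae : (fun ω => h (X T ω)) =ᵐ[Q] fun ω => g (Y ω) := by
    filter_upwards [hXY] with ω hω
    rw [hω, hgh _ (hY₀ ω)]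
  obtain ⟨hint, heq⟩ := Pricing.integral_eq_sum_A hg hY hY₀ fun d => habs d ▸ hA d
  refine ⟨hint.congr hae.symm, ?_⟩
  rw [Pricing.price, integral_const_mul, integral_congr_ae hae, heq]
  simp_rw [hAeq]
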